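/- Let $n \geq 1$ and $k \geq 2$ be integers such that $k$ divides $2(n+1)$, and let $m = (n+1)(k-2)/k$, which is a nonnegative integer. For a polynomial $P$ on $\mathbb{R}^{n+1}$ let $H(P) = \det\left(\frac{\partial^2 P}{\partial x_i \partial x_j}\right)$ be its Hessian determinant. For a smooth hypersurface $\Sigma \subset \mathbb{R}^{n+1}$ and a smooth vector field $N$ along $\Sigma$ transversal to $\Sigma$, the second fundamental form $h$ of $N$ is defined by requiring that $D_X Y - h(X,Y)N$ be tangent to $\Sigma$ for all vector fields $X, Y$ tangent to $\Sigma$, where $D$ is the standard flat connection; $\Sigma$ is nondegenerate if $h$ is nondegenerate. The field $N$ is an equiaffine normal of a nondegenerate $\Sigma$ if $D_X N$ is tangent to $\Sigma$ for every $X$ tangent to $\Sigma$, and $|\det(N, X_1, \dots, X_n)|^2 = |\det (h(X_i, X_j))|$ for all $X_1, \dots, X_n$ tangent to $\Sigma$ at a common point. A connected nondegenerate hypersurface $\Sigma$ with an equiaffine normal $N$ is a proper affine sphere centred at $v$ if $v$ lies on the line $x + \mathbb{R}N_x$ for every $x \in \Sigma$. Let $P$ be a homogeneous polynomial of degree $k$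 on $\mathbb{R}^{n+1}$ (possibly zero). (1) If $H(P) = \kappa P^m$ for some real constant $\kappa \neq 0$, then for every real $r \neq 0$ each connected component of the level set $\{x \in \mathbb{R}^{n+1} : P(x) = r\}$ is a proper affine sphere centred at the origin. (2) Conversely, if $P \neq 0$ and for every real $r \neq 0$ each connected component of $\{x \in \mathbb{R}^{n+1} : P(x) = r\}$ is a proper affine sphere centred at the origin, then there is a real constant $\kappa \neq 0$ such that $H(P) = \kappa P^m$. -/

import Mathlib

open scoped ContDiff

namespace AffineSphere

/-- The Hessian determinant `det (∂²P / ∂xᵢ∂xⱼ)` of a polynomial on `ℝ^d`, as a polynomial. -/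
noncomputable def hessianDet {d : ℕ} (P : MvPolynomial (Fin d) ℝ) : MvPolynomial (Fin d) ℝ :=
  (Matrix.of fun i j => MvPolynomial.pderiv i (MvPolynomial.pderiv j P)).det

/-- The level set `{x ∈ ℝ^d : P x = r}`. -/
def levelSet {d : ℕ} (P : MvPolynomial (Fin d) ℝ) (r : ℝ) : Set (Fin d → ℝ) :=
  {x | MvPolynomial.eval x P = r}

variable {n : ℕ}

/-- `f : U → S` is a smooth local parametrization of the set `S ⊆ ℝ^{n+1}` by an open set
`U ⊆ ℝ^n`: a smooth immersion on `U` which is a homeomorphism of `U` onto a relatively open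
subset of `S` (continuous, injective, and relatively open as a map into `S`). -/
structure IsLocalParam (S : Set (Fin (n + 1) → ℝ)) (U : Set (Fin n → ℝ))
    (f : (Fin n → ℝ) → (Fin (n + 1) → ℝ)) : Prop where
  isOpen : IsOpen U
  contDiffOn : ContDiffOn ℝ ∞ f U
  immersion : ∀ u ∈ U, Function.Injective (fderiv ℝ f u)
  injOn : Set.InjOn f U
  open_image : ∀ V ⊆ U, IsOpen V → ∃ W : Set (Fin (n + 1) → ℝ), IsOpen W ∧ f '' V = S ∩ W

/-- `S` is a smooth embedded hypersurface of `ℝ^{n+1}`. -/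
def IsSmoothHypersurface (S : Set (Fin (n + 1) → ℝ)) : Prop :=
  ∀ x ∈ S, ∃ (U : Set (Fin n → ℝ)) (f : (Fin n → ℝ) → (Fin (n + 1) → ℝ)),
    IsLocalParam S U f ∧ x ∈ f '' U

/-- The tangent space of the parametrized hypersurface `f` at `f u`. -/
noncomputable def tangentAt (f : (Fin n → ℝ) → (Fin (n + 1) → ℝ)) (u : Fin n → ℝ) :
    Submodule ℝ (Fin (n + 1) → ℝ) :=
  LinearMap.range (fderiv ℝ f u : (Fin n → ℝ) →ₗ[ℝ] (Fin (n + 1) → ℝ))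

/-- The coordinate tangent vector `∂ᵢ f` at `u`. -/
noncomputable def coordVec (f : (Fin n → ℝ) → (Fin (n + 1) → ℝ)) (u : Fin n → ℝ) (i : Fin n) :
    Fin (n + 1) → ℝ :=
  fderiv ℝ f u (Pi.single i 1)

/-- `h` is the matrix, in the coordinates of `f`, of the second fundamental form at `f u`
with respect to the transversal vector `N`: the `N`-component of `∂ᵢ ∂ⱼ f` is `h i j`. -/
def IsSecondFundamentalForm (f : (Fin n → ℝ) → (Fin (n + 1) → ℝ)) (u : Fin n → ℝ)
    (N : Fin (n + 1) → ℝ) (h : Matrix (Fin n) (Fin n) ℝ) : Prop :=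
  N ∉ tangentAt f u ∧
    ∀ i j, fderiv ℝ (fderiv ℝ f) u (Pi.single i 1) (Pi.single j 1) - h i j • N ∈ tangentAt f u

/-- `Ψ(N, ∂₁ f, …, ∂ₙ f)` for the standard volume form `Ψ` of `ℝ^{n+1}`. -/
noncomputable def inducedVolume (f : (Fin n → ℝ) → (Fin (n + 1) → ℝ)) (u : Fin n → ℝ)
    (N : Fin (n + 1) → ℝ) : ℝ :=
  (Matrix.of (Fin.cons N (coordVec f u) : Fin (n + 1) → (Fin (n + 1) → ℝ))).det

/-- `N` is an equiaffine (Blaschke) normal field of the hypersurface `S`, and `S` is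
nondegenerate. In every smooth local parametrization: `N` is smooth and transversal; its second
fundamental form `h` is nondegenerate; the volume form that `N` induces on `S` is that of the
pseudo-Riemannian metric `h`; and the connection one-form of `N` vanishes (the derivatives of `N`
along `S` are tangent to `S`). Such an `N` is unique up to sign on a connected `S`; only the
values of `N` on `S` matter. -/
def IsEquiaffineNormal (S : Set (Fin (n + 1) → ℝ))
    (N : (Fin (n + 1) → ℝ) → (Fin (n + 1) → ℝ)) : Prop :=
  ∀ (U : Set (Fin n → ℝ)) (f : (Fin n → ℝ) → (Fin (n + 1) → ℝ)), IsLocalParam S U f →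
    ContDiffOn ℝ ∞ (fun u => N (f u)) U ∧
    ∀ u ∈ U,
      (∃ h : Matrix (Fin n) (Fin n) ℝ, IsSecondFundamentalForm f u (N (f u)) h ∧ h.det ≠ 0 ∧
        inducedVolume f u (N (f u)) ^ 2 = |h.det|) ∧
      ∀ X : Fin n → ℝ, fderiv ℝ (fun u => N (f u)) u X ∈ tangentAt f u

/-- `S` is a proper affine sphere with center `v`: a connected nondegenerate smooth hypersurface
all of whose equiaffine normal lines pass through the point `v`. -/
def IsProperAffineSphere (S : Set (Fin (n + 1) → ℝ)) (v : Fin (n + 1) → ℝ) : Prop :=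
  IsConnected S ∧ IsSmoothHypersurface S ∧
    ∃ N : (Fin (n + 1) → ℝ) → (Fin (n + 1) → ℝ), IsEquiaffineNormal S N ∧
      ∀ x ∈ S, ∃ s : ℝ, v = x + s • N x

end AffineSphere

/-!
Let `P` be homogeneous of degree `k` and `S` a piece of `{P = r}` with `r ≠ 0`. By Euler's identity
`dP(x)(x) = k r ≠ 0`, so the position vector is transversal to `S`, and differentiating `P ∘ f = r`
twice shows that its second fundamental form is `-(k r)⁻¹ D²P`, restricted to the tangent spaces.
Since `D²P(x)(x, ·) = (k - 1) dP(x)`, the Hessian splits at `x` into a block on `ℝ x` and a block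
on the tangent space. Hence `c x` satisfies the volume condition at `x` if and only if
`|H(P)(x)| = |c|^(n+2) (k - 1) |k r|^(n+1)`.

If `H(P) = κ P^m`, the left-hand side is constant on `{P = r}`, and a suitable `c` exists.
Conversely, the equiaffine normal of an affine sphere centred at the origin is `φ(x) x`, and `φ` is
locally constant because `dφ(X) x` has to be tangent. So `|H(P)|` is constant on a piece of a level
set. As `H(P)` and `P^m` are both homogeneous of degree `k m`, this determines `H(P)²` on an open
cone, hence everywhere, and `H(P)` itself is then determined up to sign.
-/

namespace AffineSphere

open MvPolynomial Topology
open scoped Matrix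

section Calculus

variable {𝕜 E F G : Type*} [NontriviallyNormedField 𝕜] [NormedAddCommGroup E] [NormedSpace 𝕜 E]
  [NormedAddCommGroup F] [NormedSpace 𝕜 F] [NormedAddCommGroup G] [NormedSpace 𝕜 G]

theorem fderiv_fderiv_comp_apply {g : F → G} {f : E → F} {u : E}
    (hg : ContDiffAt 𝕜 2 g (f u)) (hf : ContDiffAt 𝕜 2 f u) (X Y : E) :
    fderiv 𝕜 (fderiv 𝕜 (g ∘ f)) u X Y =
      fderiv 𝕜 (fderiv 𝕜 g) (f u) (fderiv 𝕜 f u X) (fderiv 𝕜 f u Y) +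
        fderiv 𝕜 g (f u) (fderiv 𝕜 (fderiv 𝕜 f) u X Y) := by
  have hchain : fderiv 𝕜 (g ∘ f) =ᶠ[𝓝 u] fun v => (fderiv 𝕜 g (f v)).comp (fderiv 𝕜 f v) := by
    filter_upwards [hf.continuousAt.eventually (hg.eventually (by simp)),
      hf.eventually (by simp)] with v hgv hfv
    exact fderiv_comp v (hgv.differentiableAt (by simp)) (hfv.differentiableAt (by simp))
  have hdf : HasFDerivAt (fderiv 𝕜 f) (fderiv 𝕜 (fderiv 𝕜 f) u) u :=
    ((hf.fderiv_right (m := 1) (by norm_num)).differentiableAt (by simp)).hasFDerivAt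
  have hdg : HasFDerivAt (fderiv 𝕜 g) (fderiv 𝕜 (fderiv 𝕜 g) (f u)) (f u) :=
    ((hg.fderiv_right (m := 1) (by norm_num)).differentiableAt (by simp)).hasFDerivAt
  have hdgf := hdg.comp u (hf.differentiableAt (by simp)).hasFDerivAt
  have hcomp : HasFDerivAt (fun v => (fderiv 𝕜 g (f v)).comp (fderiv 𝕜 f v)) _ u :=
    hdgf.clm_comp hdf
  rw [hchain.fderiv_eq, hcomp.fderiv]
  simp [add_comm]

theorem differentiableAt_of_differentiableAt_smul [SeparatingDual 𝕜 F] {φ : E → 𝕜} {f : E → F}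
    {u : E} (hφf : DifferentiableAt 𝕜 (fun v => φ v • f v) u) (hf : DifferentiableAt 𝕜 f u)
    (hfu : f u ≠ 0) : DifferentiableAt 𝕜 φ u := by
  obtain ⟨l, hl⟩ := SeparatingDual.exists_ne_zero (R := 𝕜) hfu
  have hlf : DifferentiableAt 𝕜 (fun v => l (f v)) u := by fun_prop
  have hlφf : DifferentiableAt 𝕜 (fun v => l (φ v • f v)) u := by fun_prop
  have hquot : φ =ᶠ[𝓝 u] fun v => l (φ v • f v) * (l (f v))⁻¹ := by
    filter_upwards [hlf.continuousAt.eventually_ne hl] with v hv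
    rw [map_smul, smul_eq_mul, mul_inv_cancel_right₀ hv]
  exact (hlφf.fun_mul (hlf.fun_inv hl)).congr_of_eventuallyEq hquot

end Calculus

section LinearAlgebra

variable {R : Type*} [CommRing R] {n : ℕ}

theorem sq_det_cons_mul_det (Q : Matrix (Fin (n + 1)) (Fin (n + 1)) R) {v : Fin (n + 1) → R}
    {e : Fin n → Fin (n + 1) → R} (hv : ∀ j, v ⬝ᵥ Q *ᵥ e j = 0) :
    (Matrix.of (Fin.cons v e : Fin (n + 1) → Fin (n + 1) → R)).det ^ 2 * Q.det =
      (v ⬝ᵥ Q *ᵥ v) * (Matrix.of fun i j => e i ⬝ᵥ Q *ᵥ e j).det := by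
  set A := Matrix.of (Fin.cons v e : Fin (n + 1) → Fin (n + 1) → R)
  have hentry (i j) : (A * Q * Aᵀ) i j = A i ⬝ᵥ Q *ᵥ A j := (Matrix.dotProduct_mulVec _ _ _).symm
  have hrow (j : Fin n) : (A * Q * Aᵀ) 0 j.succ = 0 := (hentry 0 j.succ).trans (hv j)
  have hcorner : (A * Q * Aᵀ) 0 0 = v ⬝ᵥ Q *ᵥ v := hentry 0 0
  have hminor : (A * Q * Aᵀ).submatrix Fin.succ Fin.succ =
      Matrix.of fun i j => e i ⬝ᵥ Q *ᵥ e j := by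
    ext i j
    exact hentry i.succ j.succ
  calc A.det ^ 2 * Q.det = (A * Q * Aᵀ).det := by
        rw [Matrix.det_mul, Matrix.det_mul, Matrix.det_transpose]
        ring
    _ = (v ⬝ᵥ Q *ᵥ v) * (Matrix.of fun i j => e i ⬝ᵥ Q *ᵥ e j).det := by
        rw [Matrix.det_succ_row_zero, Fin.sum_univ_succ]
        simp only [hrow, hcorner, hminor, mul_zero, zero_mul, Finset.sum_const_zero, add_zero,
          Fin.val_zero, pow_zero, one_mul, Fin.succAbove_zero]

end LinearAlgebra

section Polynomial

theorem eval_smul_of_isHomogeneous {σ R : Type*} [CommSemiring R] {P : MvPolynomial σ R} {k : ℕ}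
    (hP : P.IsHomogeneous k) (t : R) (x : σ → R) :
    eval (t • x) P = t ^ k * eval x P := by
  rw [eval_eq, eval_eq, Finset.mul_sum]
  refine Finset.sum_congr rfl fun a ha => ?_
  simp only [Pi.smul_apply, smul_eq_mul, mul_pow, Finset.prod_mul_distrib,
    Finset.prod_pow_eq_pow_sum, ← hP.degree_eq_sum_deg_support ha]
  ring

theorem exists_eval_ne_zero {σ R : Type*} [CommRing R] [IsDomain R] [Infinite R]
    {P : MvPolynomial σ R} (hP : P ≠ 0) : ∃ x, eval x P ≠ 0 := by
  contrapose! hP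
  exact MvPolynomial.funext fun x => by rw [hP x, map_zero]

theorem eq_of_eventually_eval_eq {𝕜 σ : Type*} [NontriviallyNormedField 𝕜] {P Q : MvPolynomial σ 𝕜}
    {x : σ → 𝕜}
    (h : ∀ᶠ y in 𝓝 x, eval y P = eval y Q) : P = Q := by
  rw [nhds_pi, Filter.Eventually, Filter.mem_pi] at h
  obtain ⟨I, -, t, ht, hI⟩ := h
  exact MvPolynomial.funext_set t (fun i => infinite_of_mem_nhds (x i) (ht i)) fun y hy =>
    hI fun i _ => hy i trivial

variable {𝕜 σ : Type*} [NontriviallyNormedField 𝕜] [Fintype σ]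

theorem hasFDerivAt_eval (P : MvPolynomial σ 𝕜) (x : σ → 𝕜) :
    HasFDerivAt (fun y => eval y P)
      (∑ i, eval x (pderiv i P) • (ContinuousLinearMap.proj i : (σ → 𝕜) →L[𝕜] 𝕜)) x := by
  classical
  induction P using MvPolynomial.induction_on with
  | C a =>
    simp only [eval_C]
    refine (hasFDerivAt_const a x).congr_fderiv ?_
    ext v
    simp
  | add p q hp hq =>
    simp only [map_add]
    refine (hp.fun_add hq).congr_fderiv ?_
    ext v
    simp [add_mul, Finset.sum_add_distrib]
  | mul_X p i hp =>
    simp only [map_mul, eval_X]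
    refine (hp.fun_mul (hasFDerivAt_apply i x)).congr_fderiv ?_
    ext v
    simp [pderiv_X, Pi.single_apply, apply_ite, add_mul, Finset.sum_add_distrib, Finset.mul_sum,
      mul_assoc]

theorem fderiv_eval_apply (P : MvPolynomial σ 𝕜) (x v : σ → 𝕜) :
    fderiv 𝕜 (fun y => eval y P) x v = ∑ i, eval x (pderiv i P) * v i := by
  simp [(hasFDerivAt_eval P x).fderiv]

/-- The Hessian matrix `∂ᵢ∂ⱼP` of the polynomial function `P` at the point `x`. -/
noncomputable def hessianAt (P : MvPolynomial σ 𝕜) (x : σ → 𝕜) : Matrix σ σ 𝕜 :=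
  Matrix.of fun i j => eval x (pderiv i (pderiv j P))

theorem fderiv_fderiv_eval_apply (P : MvPolynomial σ 𝕜) (x v w : σ → 𝕜) :
    fderiv 𝕜 (fderiv 𝕜 fun y => eval y P) x v w = v ⬝ᵥ hessianAt P x *ᵥ w := by
  have hderiv : HasFDerivAt (fderiv 𝕜 fun y => eval y P)
      (∑ j, (fderiv 𝕜 (fun y => eval y (pderiv j P)) x).smulRight
        (ContinuousLinearMap.proj j : (σ → 𝕜) →L[𝕜] 𝕜)) x := by
    rw [funext fun y => (hasFDerivAt_eval P y).fderiv]
    exact HasFDerivAt.fun_sum fun j _ =>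
      (hasFDerivAt_eval (pderiv j P) x).differentiableAt.hasFDerivAt.smul_const
        (ContinuousLinearMap.proj j : (σ → 𝕜) →L[𝕜] 𝕜)
  simp only [hderiv.fderiv, sum_apply, ContinuousLinearMap.smulRight_apply, smul_apply,
    ContinuousLinearMap.proj_apply, fderiv_eval_apply, smul_eq_mul, Finset.sum_mul, dotProduct,
    Matrix.mulVec, hessianAt, Matrix.of_apply, Finset.mul_sum]
  rw [Finset.sum_comm]
  exact Finset.sum_congr rfl fun i _ => Finset.sum_congr rfl fun j _ => by ring

theorem fderiv_eval_self {σ : Type*} [Finite σ] {P : MvPolynomial σ 𝕜} {k : ℕ}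
    (hP : P.IsHomogeneous k) (x : σ → 𝕜) :
    fderiv 𝕜 (fun y => eval y P) x x = k * eval x P := by
  cases nonempty_fintype σ
  simpa [fderiv_eval_apply, mul_comm] using congrArg (eval x) hP.sum_X_mul_pderiv

theorem dotProduct_hessianAt_mulVec_self {P : MvPolynomial σ 𝕜} {k : ℕ} (hP : P.IsHomogeneous k)
    (x v : σ → 𝕜) :
    x ⬝ᵥ hessianAt P x *ᵥ v = (k - 1 : ℕ) * fderiv 𝕜 (fun y => eval y P) x v := by
  have heuler (j : σ) : (x ᵥ* hessianAt P x) j = (k - 1 : ℕ) * eval x (pderiv j P) := by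
    rw [← fderiv_eval_self hP.pderiv, fderiv_eval_apply]
    simp [Matrix.vecMul, dotProduct, hessianAt, mul_comm]
  rw [Matrix.dotProduct_mulVec]
  simp only [dotProduct, heuler, fderiv_eval_apply, Finset.mul_sum, mul_assoc]

theorem eval_hessianDet {d : ℕ} (P : MvPolynomial (Fin d) ℝ) (x : Fin d → ℝ) :
    eval x (hessianDet P) = (hessianAt P x).det :=
  RingHom.map_det _ _

theorem isHomogeneous_hessianDet {d k : ℕ} {P : MvPolynomial (Fin d) ℝ} (hP : P.IsHomogeneous k) :
    (hessianDet P).IsHomogeneous (d * (k - 2)) := by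
  rw [hessianDet, Matrix.det_apply']
  refine IsHomogeneous.sum _ _ _ fun τ _ => ?_
  have hprod : (∏ i : Fin d, pderiv (τ i) (pderiv i P)).IsHomogeneous (d * (k - 2)) := by
    simpa using IsHomogeneous.prod (Finset.univ : Finset (Fin d))
      (fun i => pderiv (τ i) (pderiv i P)) (fun _ => k - 2) fun i _ => hP.pderiv.pderiv
  simpa using hprod.C_mul (τ.sign : ℝ)

theorem contDiff_eval [CompleteSpace 𝕜] {N : WithTop ℕ∞} (P : MvPolynomial σ 𝕜) :
    ContDiff 𝕜 N fun y => eval y P :=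
  contDiffOn_univ.mp (AnalyticOnNhd.eval_mvPolynomial P).contDiffOn_of_completeSpace

end Polynomial

variable {n : ℕ} {S : Set (Fin (n + 1) → ℝ)} {U : Set (Fin n → ℝ)}
  {f : (Fin n → ℝ) → (Fin (n + 1) → ℝ)} {u : Fin n → ℝ}

section LocalParam

namespace IsLocalParam

theorem mem (hf : IsLocalParam S U f) (hu : u ∈ U) : f u ∈ S := by
  obtain ⟨W, -, hW⟩ := hf.open_image U subset_rfl hf.isOpen
  exact (hW.subset ⟨u, hu, rfl⟩).1

theorem contDiffAt (hf : IsLocalParam S U f) (hu : u ∈ U) : ContDiffAt ℝ ∞ f u :=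
  hf.contDiffOn.contDiffAt (hf.isOpen.mem_nhds hu)

theorem hasFDerivAt (hf : IsLocalParam S U f) (hu : u ∈ U) : HasFDerivAt f (fderiv ℝ f u) u :=
  ((hf.contDiffAt hu).differentiableAt (by simp)).hasFDerivAt

theorem restrict (hf : IsLocalParam S U f) {T : Set (Fin (n + 1) → ℝ)} (hT : T ⊆ S)
    {B : Set (Fin n → ℝ)} (hB : IsOpen B) (hBU : B ⊆ U) (hfB : f '' B ⊆ T) :
    IsLocalParam T B f where
  isOpen := hB
  contDiffOn := hf.contDiffOn.mono hBU
  immersion u hu := hf.immersion u (hBU hu)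
  injOn := hf.injOn.mono hBU
  open_image V hVB hV := by
    obtain ⟨W, hW, hVW⟩ := hf.open_image V (hVB.trans hBU) hV
    refine ⟨W, hW, Set.Subset.antisymm
      (Set.subset_inter ((Set.image_mono hVB).trans hfB) (hVW.subset.trans Set.inter_subset_right))
      ?_⟩
    rw [hVW]
    exact Set.inter_subset_inter_left _ hT

theorem of_leftInverse (hU : IsOpen U) (hf : ContDiffOn ℝ ∞ f U) {W : Set (Fin (n + 1) → ℝ)}
    (hW : IsOpen W) {g : (Fin (n + 1) → ℝ) → (Fin n → ℝ)} (hg : DifferentiableOn ℝ g W)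
    (hfW : ∀ u ∈ U, f u ∈ S ∩ W) (hgf : ∀ u ∈ U, g (f u) = u)
    (hfg : ∀ w ∈ S ∩ W, g w ∈ U → f (g w) = w) : IsLocalParam S U f where
  isOpen := hU
  contDiffOn := hf
  immersion u hu := by
    have hdf := ((hf.contDiffAt (hU.mem_nhds hu)).differentiableAt (by simp)).hasFDerivAt
    have hdg := (hg.differentiableAt (hW.mem_nhds (hfW u hu).2)).hasFDerivAt
    have hid : HasFDerivAt (g ∘ f) (ContinuousLinearMap.id ℝ (Fin n → ℝ)) u := by
      refine (hasFDerivAt_id u).congr_of_eventuallyEq ?_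
      filter_upwards [hU.mem_nhds hu] with v hv using hgf v hv
    exact Function.LeftInverse.injective (g := fderiv ℝ g (f u)) fun X =>
      DFunLike.congr_fun ((hdg.comp u hdf).unique hid) X
  injOn u hu v hv h := by rw [← hgf u hu, ← hgf v hv, h]
  open_image V hVU hV := by
    refine ⟨W ∩ g ⁻¹' V, hg.continuousOn.isOpen_inter_preimage hW hV, Set.Subset.antisymm ?_ ?_⟩
    · rintro _ ⟨u, hu, rfl⟩
      have huU := hVU hu
      exact ⟨(hfW u huU).1, (hfW u huU).2, by rwa [Set.mem_preimage, hgf u huU]⟩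
    · rintro w ⟨hwS, hwW, hwV⟩
      exact ⟨g w, hwV, hfg w ⟨hwS, hwW⟩ (hVU hwV)⟩

theorem finrank_tangentAt (hf : IsLocalParam S U f) (hu : u ∈ U) :
    Module.finrank ℝ (tangentAt f u) = n := by
  rw [tangentAt, LinearMap.finrank_range_of_inj (hf.immersion u hu), Module.finrank_fin_fun]

theorem tangentAt_sup_span_singleton (hf : IsLocalParam S U f) (hu : u ∈ U)
    {N : Fin (n + 1) → ℝ} (hN : N ∉ tangentAt f u) : tangentAt f u ⊔ ℝ ∙ N = ⊤ := by
  have hlt : tangentAt f u < tangentAt f u ⊔ ℝ ∙ N := by simpa using hN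
  have hfinrank := Submodule.finrank_lt_finrank_of_lt hlt
  rw [hf.finrank_tangentAt hu] at hfinrank
  refine Submodule.eq_top_of_finrank_eq (le_antisymm (Submodule.finrank_le _) ?_)
  rwa [Module.finrank_fin_fun]

theorem linearIndependent_coordVec (hf : IsLocalParam S U f) (hu : u ∈ U) :
    LinearIndependent ℝ (coordVec f u) := by
  have hcoord : coordVec f u = fderiv ℝ f u ∘ Pi.basisFun ℝ (Fin n) := by
    ext i
    simp [coordVec]
  rw [hcoord]
  exact (Pi.basisFun ℝ (Fin n)).linearIndependent.map'
    (fderiv ℝ f u : (Fin n → ℝ) →ₗ[ℝ] (Fin (n + 1) → ℝ))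
    (LinearMap.ker_eq_bot.mpr (hf.immersion u hu))

theorem inducedVolume_ne_zero (hf : IsLocalParam S U f) (hu : u ∈ U) {N : Fin (n + 1) → ℝ}
    (hN : N ∉ tangentAt f u) : inducedVolume f u N ≠ 0 := by
  have hspan : Submodule.span ℝ (Set.range (coordVec f u)) ≤ tangentAt f u := by
    rw [Submodule.span_le]
    rintro _ ⟨i, rfl⟩
    exact ⟨_, rfl⟩
  have hframe : LinearIndependent ℝ
      (Fin.cons N (coordVec f u) : Fin (n + 1) → (Fin (n + 1) → ℝ)) :=
    linearIndependent_finCons.mpr ⟨hf.linearIndependent_coordVec hu, fun h => hN (hspan h)⟩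
  exact ((Matrix.isUnit_iff_isUnit_det _).mp
    (Matrix.linearIndependent_rows_iff_isUnit.mp hframe)).ne_zero

theorem map_smul_nhds (hf : IsLocalParam S U f) (hu : u ∈ U) (hfu : f u ∉ tangentAt f u) :
    Filter.map (fun p : ℝ × (Fin n → ℝ) => p.1 • f p.2) (𝓝 (1, u)) = 𝓝 (f u) := by
  have hdf : HasStrictFDerivAt f (fderiv ℝ f u) u :=
    (hf.contDiffAt hu).hasStrictFDerivAt (by simp)
  have hcone := (hasStrictFDerivAt_fst (𝕜 := ℝ) (p := ((1 : ℝ), u))).fun_smul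
    (HasStrictFDerivAt.comp ((1 : ℝ), u) (g := f) hdf hasStrictFDerivAt_snd)
  have hmap := hcone.map_nhds_eq_of_surj (by
    rw [eq_top_iff, ← hf.tangentAt_sup_span_singleton hu hfu, sup_le_iff,
      Submodule.span_singleton_le_iff_mem]
    constructor
    · rintro _ ⟨X, rfl⟩
      exact ⟨(0, X), by simp⟩
    · exact ⟨(1, 0), by simp⟩)
  simpa using hmap

end IsLocalParam

theorem IsSmoothHypersurface.exists_isLocalParam_ball (hS : IsSmoothHypersurface S)
    {x : Fin (n + 1) → ℝ} (hx : x ∈ S) :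
    ∃ (f : (Fin n → ℝ) → (Fin (n + 1) → ℝ)) (u : Fin n → ℝ) (ε : ℝ), 0 < ε ∧
      IsLocalParam S (Metric.ball u ε) f ∧ f u = x := by
  obtain ⟨U, f, hf, u, hu, hfu⟩ := hS x hx
  obtain ⟨ε, hε, hball⟩ := Metric.isOpen_iff.mp hf.isOpen u hu
  refine ⟨f, u, ε, hε, hf.restrict subset_rfl Metric.isOpen_ball hball ?_, hfu⟩
  rintro _ ⟨v, hv, rfl⟩
  exact hf.mem (hball hv)

theorem IsSmoothHypersurface.connectedComponentIn (hS : IsSmoothHypersurface S)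
    (x : Fin (n + 1) → ℝ) : IsSmoothHypersurface (connectedComponentIn S x) := by
  intro y hy
  have hsub := connectedComponentIn_subset S x
  obtain ⟨f, u, ε, hε, hf, hfu⟩ := hS.exists_isLocalParam_ball (hsub hy)
  have hu := Metric.mem_ball_self (x := u) hε
  refine ⟨Metric.ball u ε, f, hf.restrict hsub hf.isOpen subset_rfl ?_, u, hu, hfu⟩
  rw [connectedComponentIn_eq hy]
  refine ((convex_ball u ε).isPreconnected.image f
    hf.contDiffOn.continuousOn).subset_connectedComponentIn ⟨u, hu, hfu⟩ ?_
  rintro _ ⟨v, hv, rfl⟩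
  exact hf.mem hv

end LocalParam

section LevelSet

variable {F : (Fin (n + 1) → ℝ) → ℝ} {r : ℝ}

namespace IsLocalParam

theorem comp_eventuallyEq_const (hf : IsLocalParam S U f) (hS : ∀ y ∈ S, F y = r) (hu : u ∈ U) :
    F ∘ f =ᶠ[𝓝 u] fun _ => r := by
  filter_upwards [hf.isOpen.mem_nhds hu] with v hv using hS _ (hf.mem hv)

theorem fderiv_apply_fderiv (hf : IsLocalParam S U f) (hS : ∀ y ∈ S, F y = r) (hu : u ∈ U)
    (hF : DifferentiableAt ℝ F (f u)) (X : Fin n → ℝ) :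
    fderiv ℝ F (f u) (fderiv ℝ f u X) = 0 := by
  have hconst := (hf.comp_eventuallyEq_const hS hu).fderiv_eq (𝕜 := ℝ)
  rw [fderiv_comp u hF (hf.hasFDerivAt hu).differentiableAt, fderiv_const_apply] at hconst
  exact DFunLike.congr_fun hconst X

theorem fderiv_apply_fderiv_fderiv (hf : IsLocalParam S U f) (hS : ∀ y ∈ S, F y = r)
    (hu : u ∈ U) (hF : ContDiffAt ℝ 2 F (f u)) (X Y : Fin n → ℝ) :
    fderiv ℝ F (f u) (fderiv ℝ (fderiv ℝ f) u X Y) =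
      -fderiv ℝ (fderiv ℝ F) (f u) (fderiv ℝ f u X) (fderiv ℝ f u Y) := by
  have hconst := (hf.comp_eventuallyEq_const hS hu).fderiv (𝕜 := ℝ) |>.fderiv_eq (𝕜 := ℝ)
  have hchain := fderiv_fderiv_comp_apply hF ((hf.contDiffAt hu).of_le (by norm_cast)) X Y
  rw [hconst, fderiv_fun_const] at hchain
  simp only [Pi.zero_def, fderiv_fun_const, Pi.zero_apply, zero_apply] at hchain
  linarith

theorem mem_tangentAt_iff (hf : IsLocalParam S U f) (hS : ∀ y ∈ S, F y = r) (hu : u ∈ U)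
    (hF : fderiv ℝ F (f u) ≠ 0) {v : Fin (n + 1) → ℝ} :
    v ∈ tangentAt f u ↔ fderiv ℝ F (f u) v = 0 := by
  have hFd : DifferentiableAt ℝ F (f u) := by
    by_contra h
    exact hF (fderiv_zero_of_not_differentiableAt h)
  let l : (Fin (n + 1) → ℝ) →ₗ[ℝ] ℝ := fderiv ℝ F (f u)
  have hl : l ≠ 0 := fun h => hF (ContinuousLinearMap.coe_injective h)
  have hker := Module.Dual.finrank_ker_add_one_of_ne_zero (f := l) hl
  rw [Module.finrank_fin_fun] at hker
  have htangent : tangentAt f u = LinearMap.ker l := by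
    refine Submodule.eq_of_le_of_finrank_eq ?_ (by rw [hf.finrank_tangentAt hu]; omega)
    rintro _ ⟨X, rfl⟩
    exact hf.fderiv_apply_fderiv hS hu hFd X
  rw [htangent, LinearMap.mem_ker]
  rfl

theorem isSecondFundamentalForm_iff (hf : IsLocalParam S U f) (hS : ∀ y ∈ S, F y = r)
    (hu : u ∈ U) (hF : ContDiffAt ℝ 2 F (f u)) {N : Fin (n + 1) → ℝ}
    (hN : fderiv ℝ F (f u) N ≠ 0) {h : Matrix (Fin n) (Fin n) ℝ} :
    IsSecondFundamentalForm f u N h ↔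
      ∀ i j, fderiv ℝ (fderiv ℝ F) (f u) (coordVec f u i) (coordVec f u j) =
        -fderiv ℝ F (f u) N * h i j := by
  have hF0 : fderiv ℝ F (f u) ≠ 0 := fun h0 => hN (by simp [h0])
  simp only [IsSecondFundamentalForm, hf.mem_tangentAt_iff hS hu hF0, map_sub, map_smul,
    smul_eq_mul, hf.fderiv_apply_fderiv_fderiv hS hu hF]
  rw [and_iff_right hN]
  refine forall₂_congr fun i j => ?_
  simp only [coordVec]
  constructor <;> intro hij <;> linarith

end IsLocalParam

end LevelSet

section HomogeneousLevelSet

variable {k : ℕ} {P : MvPolynomial (Fin (n + 1)) ℝ} {r c : ℝ}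

theorem fderiv_eval_self_of_mem_levelSet (hP : P.IsHomogeneous k) {x : Fin (n + 1) → ℝ}
    (hx : x ∈ levelSet P r) : fderiv ℝ (fun y => eval y P) x x = k * r := by
  rw [fderiv_eval_self hP, show eval x P = r from hx]

theorem zero_notMem_levelSet (hP : P.IsHomogeneous k) (hk : k ≠ 0) (hr : r ≠ 0) :
    0 ∉ levelSet P r := by
  intro h0
  have hself := fderiv_eval_self_of_mem_levelSet hP h0
  rw [map_zero] at hself
  exact mul_ne_zero (Nat.cast_ne_zero.mpr hk) hr hself.symm

namespace IsLocalParam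

theorem self_notMem_tangentAt (hf : IsLocalParam S U f) (hS : S ⊆ levelSet P r)
    (hP : P.IsHomogeneous k) (hk : k ≠ 0) (hr : r ≠ 0) (hu : u ∈ U) : f u ∉ tangentAt f u := by
  have hself := fderiv_eval_self_of_mem_levelSet hP (hS (hf.mem hu))
  have hkr : (k * r : ℝ) ≠ 0 := mul_ne_zero (Nat.cast_ne_zero.mpr hk) hr
  rw [hf.mem_tangentAt_iff (F := fun y => eval y P) hS hu, hself]
  · exact hkr
  · intro h0
    rw [h0] at hself
    exact hkr hself.symm

theorem isSecondFundamentalForm_smul_self_iff (hf : IsLocalParam S U f) (hS : S ⊆ levelSet P r)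
    (hP : P.IsHomogeneous k) (hk : k ≠ 0) (hr : r ≠ 0) (hc : c ≠ 0) (hu : u ∈ U)
    {h : Matrix (Fin n) (Fin n) ℝ} :
    IsSecondFundamentalForm f u (c • f u) h ↔
      (Matrix.of fun i j => coordVec f u i ⬝ᵥ hessianAt P (f u) *ᵥ coordVec f u j) =
        -(c * (k * r)) • h := by
  have hN : fderiv ℝ (fun y => eval y P) (f u) (c • f u) = c * (k * r) := by
    rw [map_smul, fderiv_eval_self_of_mem_levelSet hP (hS (hf.mem hu)), smul_eq_mul]
  have hkr : (k * r : ℝ) ≠ 0 := mul_ne_zero (Nat.cast_ne_zero.mpr hk) hr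
  rw [hf.isSecondFundamentalForm_iff (F := fun y => eval y P) hS hu (contDiff_eval P).contDiffAt
    (hN ▸ mul_ne_zero hc hkr), hN, ← Matrix.ext_iff]
  simp only [fderiv_fderiv_eval_apply, Matrix.of_apply, Matrix.smul_apply, smul_eq_mul]

theorem sq_inducedVolume_mul_abs_hessianDet (hf : IsLocalParam S U f) (hS : S ⊆ levelSet P r)
    (hP : P.IsHomogeneous k) (hk : k ≠ 0) (hr : r ≠ 0) (hc : c ≠ 0) (hu : u ∈ U)
    {h : Matrix (Fin n) (Fin n) ℝ} (hh : IsSecondFundamentalForm f u (c • f u) h) :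
    inducedVolume f u (c • f u) ^ 2 * |eval (f u) (hessianDet P)| =
      |c| ^ (n + 2) * ((k - 1 : ℕ) * |k * r| ^ (n + 1)) * |h.det| := by
  have hcone (w : Fin (n + 1) → ℝ) : (c • f u) ⬝ᵥ hessianAt P (f u) *ᵥ w =
      c * ((k - 1 : ℕ) * fderiv ℝ (fun y => eval y P) (f u) w) := by
    rw [smul_dotProduct, dotProduct_hessianAt_mulVec_self hP, smul_eq_mul]
  have horth (j : Fin n) : (c • f u) ⬝ᵥ hessianAt P (f u) *ᵥ coordVec f u j = 0 := by
    rw [hcone, coordVec, hf.fderiv_apply_fderiv (F := fun y => eval y P) hS hu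
      (hasFDerivAt_eval P (f u)).differentiableAt, mul_zero, mul_zero]
  have hdet := sq_det_cons_mul_det (hessianAt P (f u)) horth
  rw [hcone, map_smul, fderiv_eval_self_of_mem_levelSet hP (hS (hf.mem hu)),
    (hf.isSecondFundamentalForm_smul_self_iff hS hP hk hr hc hu).mp hh, Matrix.det_smul,
    Fintype.card_fin, ← eval_hessianDet] at hdet
  rw [← abs_of_nonneg (sq_nonneg (inducedVolume f u (c • f u))), ← abs_mul, inducedVolume, hdet]
  simp only [smul_eq_mul, abs_mul, abs_pow, abs_neg, Nat.abs_cast]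
  ring

theorem exists_isSecondFundamentalForm_smul_self_iff (hf : IsLocalParam S U f)
    (hS : S ⊆ levelSet P r) (hP : P.IsHomogeneous k) (hk : 2 ≤ k) (hr : r ≠ 0) (hc : c ≠ 0)
    (hu : u ∈ U) :
    (∃ h : Matrix (Fin n) (Fin n) ℝ, IsSecondFundamentalForm f u (c • f u) h ∧ h.det ≠ 0 ∧
        inducedVolume f u (c • f u) ^ 2 = |h.det|) ↔
      |eval (f u) (hessianDet P)| = |c| ^ (n + 2) * ((k - 1 : ℕ) * |k * r| ^ (n + 1)) := by
  have hk0 : k ≠ 0 := by omega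
  have hkr : (k * r : ℝ) ≠ 0 := mul_ne_zero (Nat.cast_ne_zero.mpr hk0) hr
  have hk1 : (0 : ℝ) < (k - 1 : ℕ) := Nat.cast_pos.mpr (by omega)
  have hform {h : Matrix (Fin n) (Fin n) ℝ} :=
    hf.isSecondFundamentalForm_smul_self_iff hS hP hk0 hr hc hu (h := h)
  have hvol {h : Matrix (Fin n) (Fin n) ℝ} :=
    hf.sq_inducedVolume_mul_abs_hessianDet hS hP hk0 hr hc hu (h := h)
  constructor
  · rintro ⟨h, hh, hdet, hequi⟩
    have hprod := hvol hh
    rw [hequi, mul_comm] at hprod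
    exact mul_right_cancel₀ (abs_ne_zero.mpr hdet) hprod
  · intro hH
    obtain ⟨h, hh⟩ : ∃ h, IsSecondFundamentalForm f u (c • f u) h := by
      refine ⟨_, hform.mpr (smul_inv_smul₀ (neg_ne_zero.mpr (mul_ne_zero hc hkr)) _).symm⟩
    have hequi : inducedVolume f u (c • f u) ^ 2 = |h.det| := by
      have hprod := hvol hh
      rw [hH, mul_comm] at hprod
      exact mul_left_cancel₀ (by positivity) hprod
    have hdet : |h.det| ≠ 0 := hequi ▸ pow_ne_zero 2 (hf.inducedVolume_ne_zero hu hh.1)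
    exact ⟨h, hh, abs_ne_zero.mp hdet, hequi⟩

end IsLocalParam

end HomogeneousLevelSet

section RadialParam

variable {k : ℕ} {P : MvPolynomial (Fin (n + 1)) ℝ} {r : ℝ}
  {Φ : (ℝ × (Fin n → ℝ)) ≃L[ℝ] (Fin (n + 1) → ℝ)}

theorem exists_continuousLinearEquiv_apply_one_zero_eq {z : Fin (n + 1) → ℝ} (hz : z ≠ 0) :
    ∃ Φ : (ℝ × (Fin n → ℝ)) ≃L[ℝ] (Fin (n + 1) → ℝ), Φ (1, 0) = z := by
  let Ψ : (ℝ × (Fin n → ℝ)) ≃L[ℝ] (Fin (n + 1) → ℝ) :=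
    ContinuousLinearEquiv.ofFinrankEq (by simp [add_comm])
  obtain ⟨A, hA⟩ := SeparatingDual.exists_continuousLinearEquiv_apply_eq (R := ℝ)
    (x := Ψ (1, 0)) (by simp) hz
  exact ⟨Ψ.trans A, hA⟩

/-- The radial projection of the affine hyperplane `Φ ({1} × ℝⁿ)` to the level set `{P = r}` of a
polynomial `P` homogeneous of degree `k`: the point `Φ (1, u)` is rescaled by the positive factor
that turns the value of `P` into `r`. It parametrizes the level set over the open set on which
`P (Φ (1, u))` has the sign of `r`. -/
noncomputable def radialParam (Φ : (ℝ × (Fin n → ℝ)) ≃L[ℝ] (Fin (n + 1) → ℝ))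
    (P : MvPolynomial (Fin (n + 1)) ℝ) (k : ℕ) (r : ℝ) (u : Fin n → ℝ) : Fin (n + 1) → ℝ :=
  (eval (Φ (1, u)) P / r) ^ (-(k : ℝ)⁻¹) • Φ (1, u)

theorem radialParam_mem_levelSet (hP : P.IsHomogeneous k) (hk : k ≠ 0)
    (hu : 0 < eval (Φ (1, u)) P / r) : radialParam Φ P k r u ∈ levelSet P r := by
  have hval : eval (Φ (1, u)) P ≠ 0 := fun h0 => by simp [h0] at hu
  change eval (_ • _) P = r
  rw [eval_smul_of_isHomogeneous hP, Real.rpow_neg hu.le, inv_pow,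
    Real.rpow_inv_natCast_pow hu.le hk, inv_div, div_mul_cancel₀ r hval]

theorem contDiffOn_radialParam :
    ContDiffOn ℝ ∞ (radialParam Φ P k r) {u | 0 < eval (Φ (1, u)) P / r} := by
  have hslice : ContDiff ℝ ∞ fun u => Φ (1, u) :=
    Φ.contDiff.comp (contDiff_const.prodMk contDiff_id)
  have hval : ContDiff ℝ ∞ fun u => eval (Φ (1, u)) P / r :=
    ((contDiff_eval P).comp hslice).div_const r
  exact (hval.contDiffOn.rpow_const_of_ne fun u hu => ne_of_gt hu).smul hslice.contDiffOn

theorem symm_radialParam :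
    Φ.symm (radialParam Φ P k r u) = (eval (Φ (1, u)) P / r) ^ (-(k : ℝ)⁻¹) • (1, u) := by
  rw [radialParam, map_smul, Φ.symm_apply_apply]

theorem radialParam_inv_smul (hP : P.IsHomogeneous k) (hk : k ≠ 0) (hr : r ≠ 0)
    {w : Fin (n + 1) → ℝ} (hw : w ∈ levelSet P r) (hpos : 0 < (Φ.symm w).1) :
    radialParam Φ P k r ((Φ.symm w).1⁻¹ • (Φ.symm w).2) = w := by
  set s := (Φ.symm w).1
  have hslice : Φ (1, s⁻¹ • (Φ.symm w).2) = s⁻¹ • w := by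
    have hray : ((1 : ℝ), s⁻¹ • (Φ.symm w).2) = s⁻¹ • Φ.symm w :=
      Prod.ext (inv_mul_cancel₀ hpos.ne').symm rfl
    rw [hray, map_smul, Φ.apply_symm_apply]
  have hval : eval (s⁻¹ • w) P / r = (s ^ k)⁻¹ := by
    rw [eval_smul_of_isHomogeneous hP, show eval w P = r from hw, mul_div_cancel_right₀ _ hr,
      inv_pow]
  rw [radialParam, hslice, hval, Real.rpow_neg (by positivity), Real.inv_rpow (by positivity),
    inv_inv, Real.pow_rpow_inv_natCast hpos.le hk, smul_inv_smul₀ hpos.ne']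

theorem isLocalParam_radialParam (hP : P.IsHomogeneous k) (hk : k ≠ 0) (hr : r ≠ 0) :
    IsLocalParam (levelSet P r) {u | 0 < eval (Φ (1, u)) P / r} (radialParam Φ P k r) := by
  have hscale {u : Fin n → ℝ} (hu : 0 < eval (Φ (1, u)) P / r) :
      0 < (eval (Φ (1, u)) P / r) ^ (-(k : ℝ)⁻¹) := Real.rpow_pos_of_pos hu _
  have hval : Continuous fun u => eval (Φ (1, u)) P / r :=
    ((contDiff_eval (N := 0) P).continuous.comp
      (Φ.continuous.comp (Continuous.prodMk_right 1))).div_const r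
  refine IsLocalParam.of_leftInverse (W := {w | 0 < (Φ.symm w).1})
    (g := fun w => (Φ.symm w).1⁻¹ • (Φ.symm w).2) (isOpen_lt continuous_const hval)
    contDiffOn_radialParam (isOpen_lt continuous_const (by fun_prop)) ?_ ?_ ?_ ?_
  · intro w hw
    have hfst : DifferentiableAt ℝ (fun w => (Φ.symm w).1) w := Φ.symm.differentiableAt.fst
    exact ((hfst.inv (ne_of_gt hw)).smul Φ.symm.differentiableAt.snd).differentiableWithinAt
  · intro u hu
    refine ⟨radialParam_mem_levelSet hP hk hu, ?_⟩
    simpa [symm_radialParam] using hscale hu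
  · intro u hu
    simp [symm_radialParam, smul_smul, inv_mul_cancel₀ (hscale hu).ne']
  · exact fun w hw _ => radialParam_inv_smul hP hk hr hw.1 hw.2

theorem isSmoothHypersurface_levelSet (hP : P.IsHomogeneous k) (hk : k ≠ 0) (hr : r ≠ 0) :
    IsSmoothHypersurface (levelSet P r) := by
  intro z hz
  have hz0 : z ≠ 0 := ne_of_mem_of_not_mem hz (zero_notMem_levelSet hP hk hr)
  obtain ⟨Φ, hΦ⟩ := exists_continuousLinearEquiv_apply_one_zero_eq hz0
  have hval : eval (Φ (1, 0)) P / r = 1 := by rw [hΦ, show eval z P = r from hz, div_self hr]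
  refine ⟨_, radialParam Φ P k r, isLocalParam_radialParam hP hk hr, 0, ?_, ?_⟩
  · simp [hval]
  · rw [radialParam, hval, Real.one_rpow, one_smul, hΦ]

end RadialParam

section EquiaffineNormal

variable {k m : ℕ} {P : MvPolynomial (Fin (n + 1)) ℝ} {r : ℝ}

theorem exists_isEquiaffineNormal_smul (hP : P.IsHomogeneous k) (hk : 2 ≤ k) (hr : r ≠ 0)
    (hS : S ⊆ levelSet P r) {η : ℝ} (hη : 0 < η) (hH : ∀ x ∈ S, |eval x (hessianDet P)| = η) :
    ∃ c : ℝ, c ≠ 0 ∧ IsEquiaffineNormal S fun x => c • x := by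
  have hk0 : (k : ℝ) ≠ 0 := Nat.cast_ne_zero.mpr (by omega)
  have hk1 : (0 : ℝ) < (k - 1 : ℕ) := Nat.cast_pos.mpr (by omega)
  set K : ℝ := (k - 1 : ℕ) * |k * r| ^ (n + 1)
  have hK : 0 < K := mul_pos hk1 (pow_pos (abs_pos.mpr (mul_ne_zero hk0 hr)) _)
  obtain ⟨c, hc, hcη⟩ : ∃ c : ℝ, 0 < c ∧ c ^ (n + 2) * K = η := by
    have hpos : 0 < η / K := by positivity
    refine ⟨(η / K) ^ (((n + 2 : ℕ) : ℝ)⁻¹), Real.rpow_pos_of_pos hpos _, ?_⟩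
    rw [Real.rpow_inv_natCast_pow hpos.le (by omega), div_mul_cancel₀ _ hK.ne']
  refine ⟨c, hc.ne', fun U f hf => ⟨hf.contDiffOn.const_smul c, fun u hu => ⟨?_, fun X => ?_⟩⟩⟩
  · rw [hf.exists_isSecondFundamentalForm_smul_self_iff hS hP hk hr hc.ne' hu, hH _ (hf.mem hu),
      abs_of_pos hc, hcη]
  · rw [((hf.hasFDerivAt hu).fun_const_smul c).fderiv]
    exact (tangentAt f u).smul_mem c ⟨X, rfl⟩

theorem isProperAffineSphere_connectedComponentIn_levelSet (hP : P.IsHomogeneous k) (hk : 2 ≤ k)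
    {κ : ℝ} (hκ : κ ≠ 0) (hH : hessianDet P = C κ * P ^ m) (hr : r ≠ 0) {x : Fin (n + 1) → ℝ}
    (hx : x ∈ levelSet P r) :
    IsProperAffineSphere (connectedComponentIn (levelSet P r) x) 0 := by
  have hS := connectedComponentIn_subset (levelSet P r) x
  have hHr : ∀ y ∈ connectedComponentIn (levelSet P r) x,
      |eval y (hessianDet P)| = |κ * r ^ m| := fun y hy => by
    rw [hH, map_mul, eval_C, map_pow, show eval y P = r from hS hy]
  obtain ⟨c, hc, hN⟩ := exists_isEquiaffineNormal_smul hP hk hr hS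
    (abs_pos.mpr (mul_ne_zero hκ (pow_ne_zero m hr))) hHr
  refine ⟨isConnected_connectedComponentIn_iff.mpr hx,
    (isSmoothHypersurface_levelSet hP (by omega) hr).connectedComponentIn x, _, hN,
    fun y _ => ⟨-c⁻¹, ?_⟩⟩
  rw [neg_smul, inv_smul_smul₀ hc, add_neg_cancel]

namespace IsLocalParam

theorem hasFDerivAt_zero_of_normal_eq_smul (hf : IsLocalParam S U f)
    {N : (Fin (n + 1) → ℝ) → (Fin (n + 1) → ℝ)} (hN : IsEquiaffineNormal S N)
    {φ : (Fin n → ℝ) → ℝ} (hφ : ∀ v ∈ U, N (f v) = φ v • f v) (hu : u ∈ U) :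
    HasFDerivAt φ (0 : (Fin n → ℝ) →L[ℝ] ℝ) u := by
  obtain ⟨hNs, hNu⟩ := hN U f hf
  obtain ⟨⟨h, ⟨htrans, -⟩, -⟩, htangent⟩ := hNu u hu
  have hfu : f u ∉ tangentAt f u := fun hmem =>
    htrans (hφ u hu ▸ (tangentAt f u).smul_mem (φ u) hmem)
  have hNφ : (fun v => φ v • f v) =ᶠ[𝓝 u] fun v => N (f v) := by
    filter_upwards [hf.isOpen.mem_nhds hu] with v hv using (hφ v hv).symm
  have hNd : DifferentiableAt ℝ (fun v => N (f v)) u :=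
    (hNs.contDiffAt (hf.isOpen.mem_nhds hu)).differentiableAt (by simp)
  have hφd : DifferentiableAt ℝ φ u :=
    differentiableAt_of_differentiableAt_smul (hNd.congr_of_eventuallyEq hNφ)
      (hf.hasFDerivAt hu).differentiableAt (ne_of_mem_of_not_mem (zero_mem _) hfu).symm
  have hφ0 : fderiv ℝ φ u = 0 := by
    ext1 X
    have hX := htangent X
    rw [← hNφ.fderiv_eq, (hφd.hasFDerivAt.fun_smul (hf.hasFDerivAt hu)).fderiv] at hX
    have hX' : fderiv ℝ φ u X • f u ∈ tangentAt f u :=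
      (Submodule.add_mem_iff_right _ ((tangentAt f u).smul_mem (φ u) ⟨X, rfl⟩)).mp hX
    by_contra hne
    exact hfu (((tangentAt f u).smul_mem_iff hne).mp hX')
  exact hφ0 ▸ hφd.hasFDerivAt

theorem exists_normal_eq_smul (hf : IsLocalParam S U f) (hU : IsConnected U) (h0 : 0 ∉ S)
    {N : (Fin (n + 1) → ℝ) → (Fin (n + 1) → ℝ)} (hN : IsEquiaffineNormal S N)
    (hcentre : ∀ x ∈ S, ∃ s : ℝ, 0 = x + s • N x) :
    ∃ c : ℝ, c ≠ 0 ∧ ∀ u ∈ U, N (f u) = c • f u := by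
  have hprop (u : Fin n → ℝ) (hu : u ∈ U) : ∃ a : ℝ, a ≠ 0 ∧ N (f u) = a • f u := by
    obtain ⟨s, hs⟩ := hcentre _ (hf.mem hu)
    have hs0 : s ≠ 0 := by
      rintro rfl
      rw [zero_smul, add_zero] at hs
      exact h0 (hs ▸ hf.mem hu)
    refine ⟨-s⁻¹, neg_ne_zero.mpr (inv_ne_zero hs0), ?_⟩
    have hfu : f u = -(s • N (f u)) := eq_neg_of_add_eq_zero_left hs.symm
    rw [neg_smul, ← smul_neg, eq_inv_smul_iff₀ hs0]
    exact (neg_eq_iff_eq_neg.mpr hfu).symm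
  choose! φ hφ0 hφ using hprop
  have hdφ (u : Fin n → ℝ) (hu : u ∈ U) := hf.hasFDerivAt_zero_of_normal_eq_smul hN hφ hu
  obtain ⟨c, hc⟩ := hf.isOpen.exists_is_const_of_fderiv_eq_zero hU.isPreconnected
    (fun u hu => (hdφ u hu).differentiableAt.differentiableWithinAt) fun u hu => (hdφ u hu).fderiv
  obtain ⟨u₀, hu₀⟩ := hU.nonempty
  exact ⟨c, hc u₀ hu₀ ▸ hφ0 u₀ hu₀, fun u hu => hc u hu ▸ hφ u hu⟩

theorem eq_of_isHomogeneous_of_eval_eq (hf : IsLocalParam S U f) (hu : u ∈ U)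
    (hfu : f u ∉ tangentAt f u) {p q : MvPolynomial (Fin (n + 1)) ℝ} {d : ℕ}
    (hp : p.IsHomogeneous d) (hq : q.IsHomogeneous d)
    (hpq : ∀ v ∈ U, eval (f v) p = eval (f v) q) : p = q := by
  refine eq_of_eventually_eval_eq (x := f u) ?_
  rw [← hf.map_smul_nhds hu hfu, Filter.eventually_map]
  filter_upwards [continuousAt_snd.eventually (hf.isOpen.mem_nhds hu)] with y hy
  rw [eval_smul_of_isHomogeneous hp, eval_smul_of_isHomogeneous hq, hpq _ hy]

end IsLocalParam

theorem exists_hessianDet_eq_C_mul_pow (hP : P.IsHomogeneous k) (hk : 2 ≤ k)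
    (hm : k * m = (n + 1) * (k - 2)) (hr : r ≠ 0) (hS : S ⊆ levelSet P r)
    (hsphere : IsProperAffineSphere S 0) : ∃ κ : ℝ, κ ≠ 0 ∧ hessianDet P = C κ * P ^ m := by
  obtain ⟨⟨⟨x, hx⟩, -⟩, hsmooth, N, hN, hcentre⟩ := hsphere
  have hk0 : k ≠ 0 := by omega
  have hk1 : (0 : ℝ) < (k - 1 : ℕ) := Nat.cast_pos.mpr (by omega)
  obtain ⟨f, u, ε, hε, hf, rfl⟩ := hsmooth.exists_isLocalParam_ball hx
  have hu := Metric.mem_ball_self (x := u) hε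
  obtain ⟨c, hc, hNc⟩ := hf.exists_normal_eq_smul (Metric.isConnected_ball hε)
    (fun h0 => zero_notMem_levelSet hP hk0 hr (hS h0)) hN hcentre
  set η : ℝ := |c| ^ (n + 2) * ((k - 1 : ℕ) * |k * r| ^ (n + 1))
  have hη : η ≠ 0 := by positivity
  have habs (v) (hv : v ∈ Metric.ball u ε) : |eval (f v) (hessianDet P)| = η := by
    have hequi := ((hN _ f hf).2 v hv).1
    rwa [hNc v hv, hf.exists_isSecondFundamentalForm_smul_self_iff hS hP hk hr hc hv] at hequi
  have hrm : r ^ m ≠ 0 := pow_ne_zero m hr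
  have hκ : η / r ^ m ≠ 0 := div_ne_zero hη hrm
  have hdeg : (C (η / r ^ m) * P ^ m).IsHomogeneous ((n + 1) * (k - 2)) :=
    hm ▸ (hP.pow m).C_mul _
  have hsq : hessianDet P ^ 2 = (C (η / r ^ m) * P ^ m) ^ 2 := by
    refine hf.eq_of_isHomogeneous_of_eval_eq hu (hf.self_notMem_tangentAt hS hP hk0 hr hu)
      ((isHomogeneous_hessianDet hP).pow 2) (hdeg.pow 2) fun v hv => ?_
    rw [map_pow, map_pow, ← sq_abs, habs v hv, map_mul, eval_C, map_pow,
      show eval (f v) P = r from hS (hf.mem hv), div_mul_cancel₀ _ hrm]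
  rcases eq_or_eq_neg_of_sq_eq_sq _ _ hsq with hH | hH
  · exact ⟨η / r ^ m, hκ, hH⟩
  · exact ⟨-(η / r ^ m), neg_ne_zero.mpr hκ, by rw [hH, C_neg, neg_mul]⟩

end EquiaffineNormal

end AffineSphere

theorem mainTheorem2_general (n k m : ℕ) (hk : 2 ≤ k) (hm : k * m = (n + 1) * (k - 2))
    (P : MvPolynomial (Fin (n + 1)) ℝ) (hP : P.IsHomogeneous k) :
    (∀ κ : ℝ, κ ≠ 0 → AffineSphere.hessianDet P = MvPolynomial.C κ * P ^ m →
      ∀ r : ℝ, r ≠ 0 → ∀ x ∈ AffineSphere.levelSet P r,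
        AffineSphere.IsProperAffineSphere
          (connectedComponentIn (AffineSphere.levelSet P r) x) 0) ∧
    ((∃ r : ℝ, r ≠ 0 ∧ ∃ S ⊆ AffineSphere.levelSet P r, AffineSphere.IsProperAffineSphere S 0) →
      ∃ κ : ℝ, κ ≠ 0 ∧ AffineSphere.hessianDet P = MvPolynomial.C κ * P ^ m) := by
  constructor
  · intro κ hκ hH r hr x hx
    exact AffineSphere.isProperAffineSphere_connectedComponentIn_levelSet hP hk hκ hH hr hx
  · rintro ⟨r, hr, S, hS, hsphere⟩
    exact AffineSphere.exists_hessianDet_eq_C_mul_pow hP hk hm hr hS hsphere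

theorem mainTheorem2 (n k m : ℕ) (hn : 1 ≤ n) (hk : 2 ≤ k) (hm : k * m = (n + 1) * (k - 2))
    (P : MvPolynomial (Fin (n + 1)) ℝ) (hP : P.IsHomogeneous k) :
    (∀ κ : ℝ, κ ≠ 0 → AffineSphere.hessianDet P = MvPolynomial.C κ * P ^ m →
      ∀ r : ℝ, r ≠ 0 → ∀ x ∈ AffineSphere.levelSet P r,
        AffineSphere.IsProperAffineSphere
          (connectedComponentIn (AffineSphere.levelSet P r) x) 0) ∧
    (P ≠ 0 →
      (∀ r : ℝ, r ≠ 0 → ∀ x ∈ AffineSphere.levelSet P r,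
        AffineSphere.IsProperAffineSphere
          (connectedComponentIn (AffineSphere.levelSet P r) x) 0) →
      ∃ κ : ℝ, κ ≠ 0 ∧ AffineSphere.hessianDet P = MvPolynomial.C κ * P ^ m) := by
  refine (mainTheorem2_general n k m hk hm P hP).imp_right fun hconv hP0 hsphere => ?_
  obtain ⟨x, hx⟩ := AffineSphere.exists_eval_ne_zero hP0
  exact hconv ⟨_, hx, _, connectedComponentIn_subset _ _, hsphere _ hx x rfl⟩
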